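/- **Setting.** All graphs are finite, simple and undirected. A clique of a graph $G$ is a complete subgraph; it is maximal if it is not a proper subgraph of another clique. A set $A\subseteq V(G)$ is the *inner hub* of $G$ if $V(S)\cap V(S')=A$ for any two distinct maximal cliques $S,S'$ of $G$; if $G$ is complete, its inner hub is $V(G)$. Two graphs $G,G'$ with inner hubs are *glued on a clique* $S$ if $S$ is a maximal clique of both $G$ and $G'$ and $V(G)\cap V(G')=V(S)$. The union of graphs is formed by taking the union of the vertex sets and of the edge sets. The surplus associated to a graph $G$ with vertices $v_1,\dots,v_m$ is $$b(x_1,\dots,x_m)=\sum_{\{v_i,v_j\}\in E(G)}x_i\cdot x_j,\qquad x_i\in\mathbb R^n .$$ Given open bounded sets $X_i\subseteq\mathbb R^n$ and Borel probability measures $\mu_i$ on $X_i$, $i=1,\dots,m$, a Kantorovich solution is a maximizer of $\int b\,d\gamma$ among all Borel probability measures $\gamma$ on $X_1\times\dots\times X_m$ with marginals $\mu_1,\dots,\mu_m$. It is *induced by a map* if there are measurable maps $T_i:X_1\to X_i$ with $(T_i)_\sharp\mu_1=\mu_i$, $i=2,\dots,m$, such that $\gamma=(\mathrm{Id},T_2,\dots,T_m)_\sharp\mu_1$.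 **Proposition.** Let $\{G_\alpha\}_{\alpha=1}^{l}$ be a finite family of graphs with inner hubs $A_\alpha$, and let $\bigcup_\alpha V(G_\alpha)=\{v_1,\dots,v_m\}$, where $v_1\in V(G_1)$. Let $\mathcal G$ be the graph with vertices $G_1,\dots,G_l$ in which two distinct $G_\alpha,G_\beta$ are adjacent exactly when they are glued on a clique. Assume: 1. for all $\alpha\neq\beta$, $A_\alpha\cap A_\beta=\emptyset$, and $V(G_\alpha)\cap V(G_\beta)$ is either empty, or the vertex set of a maximal clique of both $G_\alpha$ and $G_\beta$, or equal to $A_\lambda$ for some $\lambda\notin\{\alpha,\beta\}$; 2. $\mu_1$ is absolutely continuous with respect to Lebesgue measure $\mathcal L^n$ and, for each $\alpha$, there is an index $p_\alpha$ with $v_{p_\alpha}\in A_\alpha$ such that $\mu_{p_\alpha}$ is absolutely continuous with respect to $\mathcal L^n$; 3. there is a maximal clique $S$ of $G_1$ with $v_1\in V(S)$ such that $G_1$ is not glued on $S$ to any other $G_\alpha$; 4. $\mathcal G$ is a tree. Then every solution of the Kantorovich problem whose surplus is the one associated to $\bigcup_{\alpha=1}^{l}G_\alpha$ is induced by a map.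 -/

import Mathlib

open MeasureTheory

noncomputable section

namespace GraphOT

/-- A simple graph whose vertices form a subset of the finite label set `ι`, i.e. a subgraph of the
complete graph on `ι`. Its vertex set is `H.verts`, its edge set `H.edgeSet`; unions of graphs
are suprema of subgraphs (union of the vertex sets and of the edge sets). -/
abbrev VGraph (ι : Type*) := (⊤ : SimpleGraph ι).Subgraph

/-- `S` is the vertex set of a maximal clique of `H`. (A clique, being a complete subgraph, is
determined by its vertex set.) -/
def IsMaximalClique {ι : Type*} (H : VGraph ι) (S : Set ι) : Prop :=
  Maximal (fun T : Set ι => T ⊆ H.verts ∧ T.Pairwise H.Adj) S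

/-- `A` is the inner hub of `H`: any two distinct maximal cliques of `H` intersect exactly in `A`;
when `H` is complete (so that it is its own only maximal clique) the inner hub is its whole
vertex set. -/
def IsInnerHub {ι : Type*} (H : VGraph ι) (A : Set ι) : Prop :=
  A ⊆ H.verts ∧
  (∀ S T : Set ι, IsMaximalClique H S → IsMaximalClique H T → S ≠ T → S ∩ T = A) ∧
  (IsMaximalClique H H.verts → A = H.verts)

/-- `H` and `K` are glued on the clique with vertex set `S`. -/
def GluedOn {ι : Type*} (H K : VGraph ι) (S : Set ι) : Prop :=
  IsMaximalClique H S ∧ IsMaximalClique K S ∧ H.verts ∩ K.verts = S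

/-- The higher order graph of a family of graphs: its vertices are (the indices of) the members of
the family, and two of them are adjacent when they are glued on a clique. -/
def gluingGraph {ι κ : Type*} (G : κ → VGraph ι) : SimpleGraph κ where
  Adj α β := α ≠ β ∧ ∃ S, GluedOn (G α) (G β) S
  symm := ⟨by
    rintro α β ⟨hne, S, h1, h2, h3⟩
    exact ⟨hne.symm, S, h2, h1, by rw [Set.inter_comm]; exact h3⟩⟩
  loopless := ⟨fun _ h => h.1 rfl⟩

/-- The term `x_i ⬝ x_j` attached to an unordered pair `{i, j}`. -/
def edgeInner {ι : Type*} {n : ℕ} (x : ι → EuclideanSpace ℝ (Fin n)) : Sym2 ι → ℝ :=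
  Sym2.lift ⟨fun i j => inner ℝ (x i) (x j), fun i j => real_inner_comm (x j) (x i)⟩

/-- The surplus associated to a graph: the sum of `x_i ⬝ x_j` over its edges `{i, j}`. -/
def surplus {ι : Type*} [Finite ι] {n : ℕ} (H : VGraph ι)
    (x : ι → EuclideanSpace ℝ (Fin n)) : ℝ :=
  ∑ e ∈ (Set.toFinite H.edgeSet).toFinset, edgeInner x e

/-- `γ` is a Borel probability measure on the product of the `X i` with marginals `μ i`. Measures on
`X i` and on the product are regarded as measures on the ambient Euclidean spaces that vanish
outside these sets. -/
def IsTransportPlan {ι : Type*} {n : ℕ} (X : ι → Set (EuclideanSpace ℝ (Fin n)))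
    (μ : ι → Measure (EuclideanSpace ℝ (Fin n)))
    (γ : Measure (ι → EuclideanSpace ℝ (Fin n))) : Prop :=
  IsProbabilityMeasure γ ∧ γ (Set.univ.pi X)ᶜ = 0 ∧ ∀ i, γ.map (fun x => x i) = μ i

/-- `γ` solves the Kantorovich problem: it maximizes the integral of `b` among all measures on the
product of the `X i` with marginals `μ i`. -/
def IsKantorovichSolution {ι : Type*} {n : ℕ} (X : ι → Set (EuclideanSpace ℝ (Fin n)))
    (μ : ι → Measure (EuclideanSpace ℝ (Fin n)))
    (b : (ι → EuclideanSpace ℝ (Fin n)) → ℝ)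
    (γ : Measure (ι → EuclideanSpace ℝ (Fin n))) : Prop :=
  IsTransportPlan X μ γ ∧
    ∀ γ' : Measure (ι → EuclideanSpace ℝ (Fin n)), IsTransportPlan X μ γ' →
      ∫ x, b x ∂γ' ≤ ∫ x, b x ∂γ

/-- `γ` is induced by a map from the variable with label `v₁`: there are measurable maps
`T i : X v₁ → X i` pushing `μ v₁` forward to `μ i`, with `T v₁` the identity, such that `γ` is the
image of `μ v₁` under `x ↦ (T i x)_i`. -/
def IsInducedByMap {ι : Type*} {n : ℕ} (X : ι → Set (EuclideanSpace ℝ (Fin n)))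
    (μ : ι → Measure (EuclideanSpace ℝ (Fin n))) (v₁ : ι)
    (γ : Measure (ι → EuclideanSpace ℝ (Fin n))) : Prop :=
  ∃ T : ι → EuclideanSpace ℝ (Fin n) → EuclideanSpace ℝ (Fin n),
    (∀ i, Measurable (T i)) ∧ (∀ i, Set.MapsTo (T i) (X v₁) (X i)) ∧ T v₁ = id ∧
    (∀ i, (μ v₁).map (T i) = μ i) ∧ γ = (μ v₁).map (fun x i => T i x)

end GraphOT

end

noncomputable section

namespace GraphOT

/-! A maximizer is concentrated on a set where no rearrangement of coordinates among finitely many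
points increases the total surplus (`IsKantorovichSolution.isCyclicallyMonotone_support`). For the
surplus of a graph this has two consequences. First order: the surplus is affine in each `x i`, with
gradient `nbrSum`, so by the theorems of Rockafellar and Rademacher `x i` determines `nbrSum`
outside a Lebesgue null set (`IsCyclicallyMonotone.exists_null`). Second order: exchanging the
coordinates in `P` between `x` and `y` loses exactly `crossSum H P (y - x)`, which is therefore
nonnegative. When the loss is zero the exchanged points are equally good; `optimalHull` adjoins
them, so that the first order condition may be applied to points off the support.

Let `x` and `y` agree at `v₁` and put `d = y - x`. The zeros of `d` spread along the tree
(`injective_of_crossSum_nonneg`). If `d` vanishes on a hub, exchanging the coordinates on one branch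
at that hub is free, and the first order condition at the regular vertex of the hub gives `d` sum
zero over each maximal clique of that graph. A zero sum over a clique forces `d = 0` at its vertices
outside all hubs, since exchanging such a coordinate alone loses `-‖d i‖ ^ 2`. If the clique is
shared with an adjacent graph, two exchanges together force `d = 0` on the hub of that graph
(`eq_zero_on_hub_of_setSum_eq_zero`). The agreement at `v₁` starts the process. Acyclicity is what
makes a hub separate its branches.

Hence the `v₁` coordinate is injective on a Borel set of full measure, and its inverse there is the
map. -/

lemma exists_perm_of_map_univ_eq {τ β : Type*} [Fintype τ] {f g : τ → β}
    (h : (Finset.univ : Finset τ).val.map f = (Finset.univ : Finset τ).val.map g) :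
    ∃ σ : Equiv.Perm τ, ∀ k, f (σ k) = g k := by
  classical
  have hc : ∀ b, Fintype.card {k // g k = b} = Fintype.card {k // f k = b} := by
    intro b
    have := congrArg (Multiset.count b) h
    rw [Multiset.count_map, Multiset.count_map] at this
    rw [Fintype.card_subtype, Fintype.card_subtype, Finset.card_def, Finset.card_def,
      Finset.filter_val, Finset.filter_val]
    simpa [eq_comm] using this.symm
  let e : ∀ b, {k // g k = b} ≃ {k // f k = b} := fun b => Fintype.equivOfCardEq (hc b)
  exact ⟨Equiv.ofFiberEquiv e, fun k => Equiv.ofFiberEquiv_map e k⟩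

/-! ### Cyclic monotonicity -/

section CyclicMonotonicity

variable {ι : Type*} {E : Type*}

/-- Two multisets of points of a product have the same coordinate multisets. -/
def SameMarginals (M M' : Multiset (ι → E)) : Prop :=
  ∀ i, M.map (fun x => x i) = M'.map (fun x => x i)

/-- `Γ` is cyclically monotone for the surplus `b`: rearranging the coordinates of finitely many
points of `Γ` does not increase the total surplus. -/
def IsCyclicallyMonotone (b : (ι → E) → ℝ) (Γ : Set (ι → E)) : Prop :=
  ∀ M M' : Multiset (ι → E), (∀ x ∈ M, x ∈ Γ) → SameMarginals M M' →
    (M'.map b).sum ≤ (M.map b).sum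

lemma IsCyclicallyMonotone.mono {b : (ι → E) → ℝ} {Γ Γ' : Set (ι → E)}
    (h : IsCyclicallyMonotone b Γ) (hΓ : Γ' ⊆ Γ) : IsCyclicallyMonotone b Γ' :=
  fun M M' hM => h M M' fun x hx => hΓ (hM x hx)

/-- Enumerated families with equal coordinate multisets differ by one permutation per coordinate; a
coordinate must exist for the two families to have equal length. -/
lemma isCyclicallyMonotone_of_fin [Nonempty ι] {b : (ι → E) → ℝ} {Γ : Set (ι → E)}
    (h : ∀ (N : ℕ) (x y : Fin N → ι → E) (σ : ι → Equiv.Perm (Fin N)), (∀ k, x k ∈ Γ) →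
      (∀ k i, y k i = x (σ i k) i) → ∑ k, b (y k) ≤ ∑ k, b (x k)) :
    IsCyclicallyMonotone b Γ := by
  intro M M' hM hMM
  obtain ⟨i₀⟩ := ‹Nonempty ι›
  have hcard : M.card = M'.card := by simpa using congrArg Multiset.card (hMM i₀)
  obtain ⟨l, rfl⟩ : ∃ l : List (ι → E), M = l := ⟨M.toList, by simp⟩
  obtain ⟨l', rfl⟩ : ∃ l : List (ι → E), M' = l := ⟨M'.toList, by simp⟩
  have hl : l.length = l'.length := by simpa using hcard
  let x : Fin l.length → ι → E := fun k => l.get k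
  let y : Fin l.length → ι → E := fun k => l'.get (k.cast hl)
  have hx : (l : Multiset (ι → E)) = Finset.univ.val.map x := by
    rw [Fin.univ_val_map]; simp [x]
  have hy : (l' : Multiset (ι → E)) = Finset.univ.val.map y := by
    rw [Fin.univ_val_map]
    congr 1
    apply List.ext_get <;> simp [y, hl]
  rw [hx, hy] at hMM
  have hσ : ∀ i, ∃ σ : Equiv.Perm (Fin l.length), ∀ k, x (σ k) i = y k i := fun i => by
    have := hMM i
    rw [Multiset.map_map, Multiset.map_map] at this
    exact exists_perm_of_map_univ_eq this
  choose σ hσ using hσ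
  have := h _ x y σ (fun k => hM _ (by simp [x])) (fun k i => (hσ i k).symm)
  rw [hx, hy, Multiset.map_map, Multiset.map_map]
  exact this

end CyclicMonotonicity

/-! ### Cyclic monotonicity of the support of a maximizer -/

section Perturbation

variable {ι : Type*} [Fintype ι] {n : ℕ}

local notation "𝔼" => EuclideanSpace ℝ (Fin n)

lemma IsTransportPlan.of_marginals {X : ι → Set 𝔼} (hXo : ∀ i, IsOpen (X i))
    {μ : ι → Measure 𝔼} [hμp : ∀ i, IsProbabilityMeasure (μ i)] (hμX : ∀ i, μ i (X i)ᶜ = 0)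
    [Nonempty ι] {γ : Measure (ι → 𝔼)} (h : ∀ i, γ.map (fun x => x i) = μ i) :
    IsTransportPlan X μ γ := by
  refine ⟨?_, ?_, h⟩
  · obtain ⟨i₀⟩ := ‹Nonempty ι›
    have : IsProbabilityMeasure (γ.map (fun x => x i₀)) := by rw [h]; exact hμp i₀
    refine ⟨?_⟩
    rw [← Set.preimage_univ (f := fun x : ι → 𝔼 => x i₀),
      ← Measure.map_apply (measurable_pi_apply i₀) .univ]
    exact measure_univ
  · have : (Set.univ.pi X)ᶜ ⊆ ⋃ i, (fun x : ι → 𝔼 => x i) ⁻¹' (X i)ᶜ := by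
      intro x hx
      simpa [Set.mem_pi] using hx
    refine measure_mono_null this (measure_iUnion_null fun i => ?_)
    rw [← Measure.map_apply (by fun_prop) (hXo i).measurableSet.compl, h, hμX]

lemma IsTransportPlan.integrable {X : ι → Set 𝔼} (hXb : ∀ i, Bornology.IsBounded (X i))
    {μ : ι → Measure 𝔼} {γ : Measure (ι → 𝔼)} (h : IsTransportPlan X μ γ)
    {b : (ι → 𝔼) → ℝ} (hb : Continuous b) : Integrable b γ := by
  have := h.1
  have hbd : Bornology.IsBounded (Set.univ.pi X) := Bornology.IsBounded.pi hXb
  obtain ⟨C, hC⟩ := (hbd.isCompact_closure.image hb).isBounded.exists_norm_le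
  refine Integrable.of_bound hb.aestronglyMeasurable C ?_
  have : ∀ᵐ x ∂γ, x ∈ Set.univ.pi X := h.2.1
  filter_upwards [this] with x hx
  exact hC _ ⟨x, subset_closure hx, rfl⟩

/-- Averages of a function that is almost constant on a set. -/
lemma abs_integral_sub_le {Ω : Type*} [MeasurableSpace Ω] {ρ : Measure Ω} [IsProbabilityMeasure ρ]
    {b : Ω → ℝ} {c ε : ℝ} (hb : AEStronglyMeasurable b ρ) (h : ∀ᵐ x ∂ρ, |b x - c| ≤ ε) :
    Integrable b ρ ∧ |∫ x, b x ∂ρ - c| ≤ ε := by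
  have hint : Integrable (fun x => b x - c) ρ :=
    Integrable.of_bound (hb.sub aestronglyMeasurable_const) ε (by simpa using h)
  have hbi : Integrable b ρ := by
    simpa [Pi.add_def] using hint.add (integrable_const c)
  refine ⟨hbi, ?_⟩
  have h1 := norm_integral_le_of_norm_le_const (μ := ρ) (f := fun x => b x - c) (C := ε)
    (by simpa using h)
  rw [integral_sub hbi (integrable_const c)] at h1
  simpa using h1

/-- The support of a maximizer of a continuous surplus is cyclically monotone. -/
theorem IsKantorovichSolution.isCyclicallyMonotone_support [Nonempty ι]
    {X : ι → Set 𝔼} (hXo : ∀ i, IsOpen (X i)) (hXb : ∀ i, Bornology.IsBounded (X i))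
    {μ : ι → Measure 𝔼} [hμp : ∀ i, IsProbabilityMeasure (μ i)] (hμX : ∀ i, μ i (X i)ᶜ = 0)
    {b : (ι → 𝔼) → ℝ} (hb : Continuous b) {γ : Measure (ι → 𝔼)}
    (hγ : IsKantorovichSolution X μ b γ) : IsCyclicallyMonotone b γ.support := by
  classical
  refine isCyclicallyMonotone_of_fin fun N x y σ hx hy => ?_
  have hγp := hγ.1.1
  refine le_of_forall_pos_le_add fun δ hδ => ?_
  -- Each of the two sums of `N` averages below has error at most `N * ε`.
  obtain ⟨ε, hε, hεδ⟩ : ∃ ε > 0, 2 * N * ε ≤ δ :=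
    ⟨δ / (2 * (N + 1)), by positivity, by
      have : (0 : ℝ) < 2 * (N + 1) := by positivity
      rw [mul_div_assoc', div_le_iff₀ this]; nlinarith⟩
  have hcont : ∀ z : ι → 𝔼, ∀ᶠ r in nhdsWithin (0 : ℝ) (Set.Ioi 0),
      ∀ u ∈ Metric.ball z r, |b u - b z| ≤ ε := by
    intro z
    obtain ⟨r, hr, h⟩ := Metric.continuous_iff.1 hb z ε hε
    filter_upwards [Ioo_mem_nhdsGT hr] with s hs u hu
    exact (h u (lt_trans hu hs.2)).le
  obtain ⟨r, ⟨hrx, hry⟩, hr⟩ := (((Filter.eventually_all.2 fun k => hcont (x k)).and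
    (Filter.eventually_all.2 fun k => hcont (y k))).and self_mem_nhdsWithin).exists
  have hr : 0 < r := hr
  set U : Fin N → Set (ι → 𝔼) := fun k => Metric.ball (x k) r with hU
  have hUm : ∀ k, MeasurableSet (U k) := fun k => measurableSet_ball
  have hUpos : ∀ k, 0 < γ (U k) := fun k =>
    (Measure.mem_support_iff_forall _).1 (hx k) _ (Metric.ball_mem_nhds _ hr)
  have hUne : ∀ k, γ (U k) ≠ 0 := fun k => (hUpos k).ne'
  -- This bound makes each `c • g k` at most `γ / N`, so that their sum can be removed from `γ`. All
  -- masses being at most one, their product is a common positive lower bound; `N + 1` avoids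
  -- division by zero.
  obtain ⟨c, hc0, hc⟩ : ∃ c : NNReal, 0 < c ∧ ∀ k, (N : ENNReal) * c ≤ γ (U k) := by
    have ha : ∀ k, ∃ a : NNReal, (a : ENNReal) = γ (U k) := fun k =>
      ⟨_, ENNReal.coe_toNNReal (measure_ne_top _ _)⟩
    choose a ha using ha
    have ha0 : ∀ k, 0 < a k := fun k => by exact_mod_cast (ha k).symm ▸ hUpos k
    have ha1 : ∀ k, a k ≤ 1 := fun k => by
      have : γ (U k) ≤ 1 := prob_le_one
      rw [← ha] at this
      exact_mod_cast this
    refine ⟨(∏ k, a k) / (N + 1), div_pos (Finset.prod_pos fun k _ => ha0 k) (by positivity),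
      fun k => ?_⟩
    have h1 : ∏ k, a k ≤ a k := by
      rw [← Finset.mul_prod_erase _ _ (Finset.mem_univ k)]
      exact mul_le_of_le_one_right' (Finset.prod_le_one' fun j _ => ha1 j)
    have h2 : (N : NNReal) * ((∏ k, a k) / (N + 1)) ≤ a k :=
      calc (N : NNReal) * ((∏ k, a k) / (N + 1)) = (N / (N + 1)) * ∏ k, a k := by ring
        _ ≤ 1 * ∏ k, a k := by
            gcongr
            exact div_le_one_of_le₀ (by simp) (by positivity)
        _ ≤ _ := by simpa using h1
    rw [← ha]
    exact_mod_cast h2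
  set g : Fin N → Measure (ι → 𝔼) := fun k => ProbabilityTheory.cond γ (U k) with hg
  have hgp : ∀ k, IsProbabilityMeasure (g k) := fun k =>
    ProbabilityTheory.cond_isProbabilityMeasure (hUne k)
  have hmeas : ∀ i : ι, Measurable (fun x : ι → 𝔼 => x i) := fun i => by fun_prop
  have hmp : ∀ k i, IsProbabilityMeasure ((g k).map (fun x => x i)) := fun k i =>
    Measure.isProbabilityMeasure_map (hmeas i).aemeasurable
  -- Coordinate `i` is drawn from the ball around `x (σ i k)`, so `q k` lives near `y k`; summed
  -- over `k`, the marginals of the `g k` are merely permuted.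
  set q : Fin N → Measure (ι → 𝔼) := fun k =>
    Measure.pi fun i => (g (σ i k)).map (fun x => x i) with hq
  have hqp : ∀ k, IsProbabilityMeasure (q k) := fun k => by rw [hq]; infer_instance
  have hqmap : ∀ k i, (q k).map (fun x => x i) = (g (σ i k)).map (fun x => x i) := fun k i =>
    (measurePreserving_eval (fun i => (g (σ i k)).map (fun x : ι → 𝔼 => x i)) i).map_eq
  set ν : Measure (ι → 𝔼) := ∑ k, c • g k with hν
  set ν' : Measure (ι → 𝔼) := ∑ k, c • q k with hν'
  have hνle : ν ≤ γ := by
    refine Measure.le_iff.2 fun s hs => ?_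
    rw [hν, Measure.finsetSum_apply]
    rcases Nat.eq_zero_or_pos N with hN | hN
    · subst hN; simp
    have hN' : (N : ENNReal) ≠ 0 := by simpa using hN.ne'
    calc ∑ k, (c • g k) s ≤ ∑ k : Fin N, (N : ENNReal)⁻¹ * γ s := by
          refine Finset.sum_le_sum fun k _ => ?_
          rw [Measure.smul_apply, hg, ProbabilityTheory.cond_apply (hUm k), ENNReal.smul_def,
            smul_eq_mul, ← mul_assoc]
          refine mul_le_mul' ?_ (measure_mono Set.inter_subset_right)
          rw [ENNReal.le_inv_iff_mul_le, mul_right_comm, mul_comm (c : ENNReal),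
            ← div_eq_mul_inv]
          exact ENNReal.div_le_of_le_mul (by simpa using hc k)
      _ = γ s := by
          rw [Finset.sum_const, Finset.card_univ, Fintype.card_fin, nsmul_eq_mul, ← mul_assoc,
            ENNReal.mul_inv_cancel hN' (by simp), one_mul]
  have : IsFiniteMeasure ν := isFiniteMeasure_of_le γ hνle
  have hdec : γ - ν + ν = γ := Measure.sub_add_cancel_of_le hνle
  have hmapsum : ∀ (i : ι) (m : Fin N → Measure (ι → 𝔼)),
      (∑ k, c • m k).map (fun x => x i) = ∑ k, c • (m k).map (fun x => x i) := fun i m => by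
    rw [← Measure.mapₗ_apply_of_measurable (hmeas i), map_sum]
    refine Finset.sum_congr rfl fun k _ => ?_
    rw [Measure.mapₗ_apply_of_measurable (hmeas i), Measure.map_smul]
  have hmarg : ∀ i, ν'.map (fun x => x i) = ν.map (fun x => x i) := by
    intro i
    rw [hν, hν', hmapsum, hmapsum]
    simp_rw [hqmap]
    exact Equiv.sum_comp (σ i) fun k => c • (g k).map (fun x => x i)
  have hplan : IsTransportPlan X μ (γ - ν + ν') := by
    refine IsTransportPlan.of_marginals hXo hμX fun i => ?_
    rw [Measure.map_add _ _ (hmeas i), hmarg, ← Measure.map_add _ _ (hmeas i), hdec, hγ.1.2.2]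
  have hopt := hγ.2 _ hplan
  have hbγ := hγ.1.integrable hXb hb
  have hg1 : ∀ k, Integrable b (g k) ∧ |∫ u, b u ∂(g k) - b (x k)| ≤ ε := fun k => by
    refine abs_integral_sub_le hb.aestronglyMeasurable ?_
    filter_upwards [ProbabilityTheory.ae_cond_mem (μ := γ) (hUm k)] with u hu
    exact hrx k u hu
  have hq1 : ∀ k, Integrable b (q k) ∧ |∫ u, b u ∂(q k) - b (y k)| ≤ ε := fun k => by
    refine abs_integral_sub_le hb.aestronglyMeasurable ?_
    have h1 : ∀ i, ∀ᵐ u ∂(q k), u i ∈ Metric.ball (y k i) r := fun i => by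
      have h2 : ∀ᵐ t ∂((q k).map fun x => x i), t ∈ Metric.ball (y k i) r := by
        rw [hqmap]
        refine (ae_map_iff (p := fun t => t ∈ Metric.ball (y k i) r) (hmeas i).aemeasurable
          measurableSet_ball).2 ?_
        filter_upwards [ProbabilityTheory.ae_cond_mem (μ := γ) (hUm (σ i k))] with u hu
        rw [hy]
        exact (dist_pi_lt_iff hr).1 hu i
      exact ae_of_ae_map (hmeas i).aemeasurable h2
    filter_upwards [ae_all_iff.2 h1] with u hu
    exact hry k u ((dist_pi_lt_iff hr).2 hu)
  have hint : ∀ m : Fin N → Measure (ι → 𝔼), (∀ k, Integrable b (m k)) →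
      Integrable b (∑ k, c • m k) ∧ ∫ u, b u ∂(∑ k, c • m k) = c * ∑ k, ∫ u, b u ∂(m k) := by
    intro m hm
    have h1 : ∀ k ∈ (Finset.univ : Finset (Fin N)), Integrable b (c • m k) :=
      fun k _ => (hm k).smul_measure_nnreal
    refine ⟨integrable_finsetSum_measure.2 h1, ?_⟩
    rw [integral_finsetSum_measure h1, Finset.mul_sum]
    refine Finset.sum_congr rfl fun k _ => ?_
    rw [integral_smul_nnreal_measure]; rfl
  obtain ⟨hi1, he1⟩ := hint g fun k => (hg1 k).1
  obtain ⟨hi2, he2⟩ := hint q fun k => (hq1 k).1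
  have hi0 : Integrable b (γ - ν) := hbγ.mono_measure Measure.sub_le
  rw [integral_add_measure hi0 hi2] at hopt
  have h3 : ∫ u, b u ∂γ = ∫ u, b u ∂(γ - ν) + ∫ u, b u ∂ν := by
    rw [← integral_add_measure hi0 hi1, hdec]
  rw [h3, he1, he2] at hopt
  have h4 : ∑ k, ∫ u, b u ∂(q k) ≤ ∑ k, ∫ u, b u ∂(g k) :=
    le_of_mul_le_mul_left (by linarith) (NNReal.coe_pos.2 hc0)
  have h5 : ∑ k, (b (y k) - ε) ≤ ∑ k, ∫ u, b u ∂(q k) :=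
    Finset.sum_le_sum fun k _ => by linarith [(abs_le.1 (hq1 k).2).1]
  have h6 : ∑ k, ∫ u, b u ∂(g k) ≤ ∑ k, (b (x k) + ε) :=
    Finset.sum_le_sum fun k _ => by linarith [(abs_le.1 (hg1 k).2).2]
  simp only [Finset.sum_sub_distrib, Finset.sum_add_distrib, Finset.sum_const, Finset.card_univ,
    Fintype.card_fin, nsmul_eq_mul] at h5 h6
  linarith

end Perturbation

/-! ### Optimal rearrangements and exchanges -/

section Hull

variable {ι : Type*} {E : Type*}

lemma SameMarginals.add {M M' L L' : Multiset (ι → E)} (h : SameMarginals M M')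
    (h' : SameMarginals L L') : SameMarginals (M + L) (M' + L') := fun i => by
  rw [Multiset.map_add, Multiset.map_add, h i, h' i]

lemma SameMarginals.trans {M M' M'' : Multiset (ι → E)} (h : SameMarginals M M')
    (h' : SameMarginals M' M'') : SameMarginals M M'' := fun i => (h i).trans (h' i)

lemma SameMarginals.refl (M : Multiset (ι → E)) : SameMarginals M M := fun _ => rfl

/-- The points that occur in optimal rearrangements of finitely many points of `Γ`. -/
def optimalHull (b : (ι → E) → ℝ) (Γ : Set (ι → E)) : Set (ι → E) :=
  {m | ∃ M L : Multiset (ι → E), (∀ x ∈ M, x ∈ Γ) ∧ SameMarginals M (m ::ₘ L) ∧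
    (M.map b).sum = b m + (L.map b).sum}

lemma subset_optimalHull (b : (ι → E) → ℝ) (Γ : Set (ι → E)) : Γ ⊆ optimalHull b Γ :=
  fun x hx => ⟨{x}, 0, by simpa using hx, fun _ => rfl, by simp⟩

lemma exists_apply_eq_of_mem_optimalHull {b : (ι → E) → ℝ} {Γ : Set (ι → E)} {m : ι → E}
    (hm : m ∈ optimalHull b Γ) (i : ι) : ∃ x ∈ Γ, x i = m i := by
  obtain ⟨M, L, hM, hML, -⟩ := hm
  have : m i ∈ M.map (fun x => x i) := by rw [hML i]; simp
  obtain ⟨x, hx, h⟩ := Multiset.mem_map.1 this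
  exact ⟨x, hM x hx, h⟩

lemma exists_of_forall_mem_optimalHull {b : (ι → E) → ℝ} {Γ : Set (ι → E)}
    (K : Multiset (ι → E)) (hK : ∀ x ∈ K, x ∈ optimalHull b Γ) :
    ∃ M L : Multiset (ι → E), (∀ x ∈ M, x ∈ Γ) ∧ SameMarginals M (K + L) ∧
      (M.map b).sum = (K.map b).sum + (L.map b).sum := by
  induction K using Multiset.induction with
  | empty => exact ⟨0, 0, by simp, fun _ => by simp, by simp⟩
  | cons m K ih =>
    obtain ⟨M, L, hM, hML, hs⟩ := ih fun x hx => hK x (Multiset.mem_cons_of_mem hx)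
    obtain ⟨M₁, L₁, hM₁, hML₁, hs₁⟩ := hK m (Multiset.mem_cons_self m K)
    refine ⟨M₁ + M, L₁ + L, ?_, ?_, ?_⟩
    · intro x hx
      rcases Multiset.mem_add.1 hx with h | h
      exacts [hM₁ x h, hM x h]
    · have := hML₁.add hML
      rwa [show m ::ₘ L₁ + (K + L) = m ::ₘ K + (L₁ + L) by
        rw [← Multiset.singleton_add, ← Multiset.singleton_add]; abel] at this
    · simp only [Multiset.map_add, Multiset.sum_add, Multiset.map_cons, Multiset.sum_cons, hs, hs₁]
      ring

/-- Complete the given points by `L` to an optimal rearrangement of points of `Γ`. Rearranging them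
again rearranges the original points, and the contribution of `L` cancels. -/
lemma IsCyclicallyMonotone.optimalHull {b : (ι → E) → ℝ} {Γ : Set (ι → E)}
    (h : IsCyclicallyMonotone b Γ) : IsCyclicallyMonotone b (optimalHull b Γ) := by
  intro K K' hK hKK
  obtain ⟨M, L, hM, hML, hs⟩ := exists_of_forall_mem_optimalHull K hK
  have := h M (K' + L) hM (hML.trans (hKK.add (.refl L)))
  rw [Multiset.map_add, Multiset.sum_add] at this
  linarith

variable {x y : ι → E}

open Classical in
/-- The point with the coordinates of `y` on `P` and those of `x` elsewhere. -/
def mix (P : Set ι) (x y : ι → E) : ι → E := fun i => if i ∈ P then y i else x i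

lemma mix_of_mem {P : Set ι} {i : ι} (h : i ∈ P) : mix P x y i = y i := if_pos h

lemma mix_of_notMem {P : Set ι} {i : ι} (h : i ∉ P) : mix P x y i = x i := if_neg h

lemma sameMarginals_mix (P : Set ι) (x y : ι → E) :
    SameMarginals {x, y} {mix P x y, mix P y x} := by
  intro i
  by_cases h : i ∈ P
  · simpa [mix_of_mem h] using Multiset.pair_comm (x i) (y i)
  · simp [mix_of_notMem h]

lemma IsCyclicallyMonotone.mix_le {b : (ι → E) → ℝ} {Γ : Set (ι → E)}
    (h : IsCyclicallyMonotone b Γ) (hx : x ∈ Γ) (hy : y ∈ Γ) (P : Set ι) :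
    b (mix P x y) + b (mix P y x) ≤ b x + b y := by
  have := h {x, y} _ (by simp [hx, hy]) (sameMarginals_mix P x y)
  simpa using this

lemma mix_mem_optimalHull {b : (ι → E) → ℝ} {Γ : Set (ι → E)}
    (hx : x ∈ optimalHull b Γ) (hy : y ∈ optimalHull b Γ) {P : Set ι}
    (h : b (mix P x y) + b (mix P y x) = b x + b y) : mix P x y ∈ optimalHull b Γ := by
  obtain ⟨M, L, hM, hML, hs⟩ := exists_of_forall_mem_optimalHull {x, y}
    (b := b) (Γ := Γ) (by simp [hx, hy])
  refine ⟨M, mix P y x ::ₘ L, hM, ?_, ?_⟩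
  · refine hML.trans (((sameMarginals_mix P x y).add (.refl L)).trans fun i => ?_)
    simp
  · rw [hs]
    simp
    linarith

end Hull

/-! ### Rockafellar's theorem and single-valuedness almost everywhere -/

section Rockafellar

variable {E : Type*} [NormedAddCommGroup E] [InnerProductSpace ℝ E]

/-- The pairs `(p, c)`, where `p` is the end of a chain of points of `S` that starts in `p₀`, and
`c` is the increment along this chain. -/
inductive IsChainValue (S : Set (E × E)) (p₀ : E × E) : E × E → ℝ → Prop
  | start : IsChainValue S p₀ p₀ 0
  | step {p : E × E} {c : ℝ} {q : E × E} : IsChainValue S p₀ p c → q ∈ S →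
      IsChainValue S p₀ q (c + inner ℝ p.2 (q.1 - p.1))

/-- **Rockafellar's theorem** for bounded sets of gradients. -/
theorem exists_lipschitzWith_subgradient {S : Set (E × E)} {R : NNReal}
    (hR : ∀ p ∈ S, ‖p.2‖ ≤ R)
    (hS : ∀ p₀ ∈ S, ∀ p c, IsChainValue S p₀ p c → c + inner ℝ p.2 (p₀.1 - p.1) ≤ 0) :
    ∃ φ : E → ℝ, LipschitzWith R φ ∧
      ∀ p ∈ S, ∀ t, φ p.1 + inner ℝ p.2 (t - p.1) ≤ φ t := by
  rcases S.eq_empty_or_nonempty with rfl | ⟨p₀, hp₀⟩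
  · exact ⟨0, LipschitzWith.const' 0, by simp⟩
  -- The potential is the supremum of the affine functions given by the chains from `p₀`. Closing a
  -- chain at `p₀` bounds it above, and extending a chain by one point gives the subgradient
  -- inequality.
  let V : E → Set ℝ := fun t =>
    {v | ∃ p c, IsChainValue S p₀ p c ∧ v = c + inner ℝ p.2 (t - p.1)}
  have hmem : ∀ p c, IsChainValue S p₀ p c → p ∈ S := by
    intro p c h
    cases h with
    | start => exact hp₀
    | step _ h => exact h
  have hne : ∀ t, (V t).Nonempty := fun t => ⟨_, p₀, 0, .start, rfl⟩
  have hshift : ∀ p ∈ S, ∀ c t t', c + inner ℝ p.2 (t - p.1) ≤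
      c + inner ℝ p.2 (t' - p.1) + R * ‖t - t'‖ := by
    intro p hp c t t'
    have h1 : inner ℝ p.2 (t - p.1) = inner ℝ p.2 (t' - p.1) + inner ℝ p.2 (t - t') := by
      rw [← inner_add_right]; congr 1; abel
    have h2 := (real_inner_le_norm p.2 (t - t')).trans
      (mul_le_mul_of_nonneg_right (hR p hp) (norm_nonneg _))
    linarith
  have hbdd : ∀ t, BddAbove (V t) := fun t => ⟨R * ‖t - p₀.1‖, by
    rintro v ⟨p, c, h, rfl⟩
    have := hshift p (hmem p c h) c t p₀.1
    linarith [hS p₀ hp₀ p c h]⟩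
  refine ⟨fun t => sSup (V t), LipschitzWith.of_le_add_mul R fun t t' => ?_, fun p hp t => ?_⟩
  · refine csSup_le (hne t) ?_
    rintro v ⟨p, c, h, rfl⟩
    have h1 := hshift p (hmem p c h) c t t'
    have h2 : c + inner ℝ p.2 (t' - p.1) ≤ sSup (V t') := le_csSup (hbdd t') ⟨p, c, h, rfl⟩
    rw [dist_eq_norm]
    linarith
  · rw [← le_sub_iff_add_le]
    refine csSup_le (hne _) ?_
    rintro v ⟨q, c, h, rfl⟩
    rw [le_sub_iff_add_le]
    exact le_csSup (hbdd t) ⟨p, _, h.step hp, rfl⟩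

/-- Subtracting the linear function of a subgradient leaves a minimum at `t`, so the subgradient is
the derivative. -/
lemma eq_of_subgradient {φ : E → ℝ} {t z z' : E} (hφ : DifferentiableAt ℝ φ t)
    (hz : ∀ s, φ t + inner ℝ z (s - t) ≤ φ s) (hz' : ∀ s, φ t + inner ℝ z' (s - t) ≤ φ s) :
    z = z' := by
  have key : ∀ w : E, (∀ s, φ t + inner ℝ w (s - t) ≤ φ s) → fderiv ℝ φ t = innerSL ℝ w := by
    intro w hw
    have hmin : IsLocalMin (fun s => φ s - innerSL ℝ w s) t := by
      refine Filter.Eventually.of_forall fun s => ?_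
      have := hw s
      rw [inner_sub_right] at this
      simp only [innerSL_apply_apply]
      linarith
    have h0 := hmin.fderiv_eq_zero
    have h1 : HasFDerivAt (fun s => φ s - innerSL ℝ w s) (fderiv ℝ φ t - innerSL ℝ w) t :=
      hφ.hasFDerivAt.sub (innerSL ℝ w).hasFDerivAt
    rw [h1.fderiv] at h0
    exact sub_eq_zero.1 h0
  have h := (key z hz).symm.trans (key z' hz')
  refine ext_inner_right ℝ fun v => ?_
  simpa using congrArg (fun f : E →L[ℝ] ℝ => f v) h

/-- A bounded cyclically monotone set is single-valued outside of a null set. -/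
theorem exists_null_forall_eq [FiniteDimensional ℝ E] [MeasurableSpace E] [BorelSpace E]
    (vol : Measure E) [vol.IsAddHaarMeasure] {S : Set (E × E)} {R : ℝ}
    (hR : ∀ p ∈ S, ‖p.2‖ ≤ R)
    (hS : ∀ p₀ ∈ S, ∀ p c, IsChainValue S p₀ p c → c + inner ℝ p.2 (p₀.1 - p.1) ≤ 0) :
    ∃ N : Set E, MeasurableSet N ∧ vol N = 0 ∧
      ∀ p ∈ S, ∀ q ∈ S, p.1 = q.1 → p.1 ∉ N → p.2 = q.2 := by
  obtain ⟨φ, hL, hφ⟩ := exists_lipschitzWith_subgradient (R := R.toNNReal)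
    (fun p hp => (hR p hp).trans (Real.le_coe_toNNReal R)) hS
  -- Rademacher's theorem.
  have hae : vol {t | ¬ DifferentiableAt ℝ φ t} = 0 := hL.ae_differentiableAt (μ := vol)
  refine ⟨toMeasurable vol {t | ¬ DifferentiableAt ℝ φ t}, measurableSet_toMeasurable _ _,
    by rw [measure_toMeasurable, hae], fun p hp q hq hpq hN => ?_⟩
  have hd : DifferentiableAt ℝ φ p.1 := by
    by_contra h
    exact hN (subset_toMeasurable _ _ h)
  exact eq_of_subgradient hd (hφ p hp) (hpq ▸ hφ q hq)

end Rockafellar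

/-! ### The surplus of a graph: first and second order conditions -/

open Classical in
lemma two_mul_surplus {ι : Type*} [Fintype ι] {n : ℕ} (H : VGraph ι)
    (x : ι → EuclideanSpace ℝ (Fin n)) :
    2 * surplus H x = ∑ i, ∑ j, if H.Adj i j then inner ℝ (x i) (x j) else 0 := by
  rw [← Fintype.sum_prod_type' (f := fun i j => if H.Adj i j then inner ℝ (x i) (x j) else 0),
    ← Finset.sum_filter, surplus, Finset.mul_sum,
    ← Finset.sum_fiberwise_of_maps_to (g := fun p : ι × ι => s(p.1, p.2))
      (t := (Set.toFinite H.edgeSet).toFinset)]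
  · refine Finset.sum_congr rfl fun e he => ?_
    induction e using Sym2.ind with | _ a b =>
    have hab : H.Adj a b := by simpa using he
    have : (Finset.univ.filter fun p : ι × ι => H.Adj p.1 p.2).filter
        (fun p => s(p.1, p.2) = s(a, b)) = {(a, b), (b, a)} := by
      ext ⟨c, d⟩
      simp only [Finset.mem_filter, Finset.mem_univ, true_and, Sym2.eq_iff, Finset.mem_insert,
        Finset.mem_singleton, Prod.mk.injEq]
      refine ⟨fun h => h.2, fun h => ⟨?_, h⟩⟩
      rcases h with ⟨rfl, rfl⟩ | ⟨rfl, rfl⟩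
      exacts [hab, hab.symm]
    rw [this, Finset.sum_pair (by simp [hab.ne])]
    simp only [edgeInner, Sym2.lift_mk]
    rw [real_inner_comm (x b) (x a)]
    ring
  · intro p hp
    simpa using hp

section Surplus

variable {ι : Type*} [Fintype ι] {n : ℕ}

local notation "𝔼" => EuclideanSpace ℝ (Fin n)

lemma continuous_surplus (H : VGraph ι) : Continuous (surplus (n := n) H) := by
  refine continuous_finsetSum _ fun e _ => ?_
  induction e using Sym2.ind with | _ a b =>
  change Continuous fun x : ι → 𝔼 => inner ℝ (x a) (x b)
  exact Continuous.inner (by fun_prop) (by fun_prop)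

open Classical in
/-- The sum of `x j` over the neighbours `j` of `i`. -/
def nbrSum (H : VGraph ι) (x : ι → 𝔼) (i : ι) : 𝔼 := ∑ j, if H.Adj i j then x j else 0

open Classical in
/-- The sum of `d i ⬝ d j` over the edges `{i, j}` that leave `P`. -/
def crossSum (H : VGraph ι) (P : Set ι) (d : ι → 𝔼) : ℝ :=
  ∑ i, ∑ j, if H.Adj i j ∧ i ∈ P ∧ j ∉ P then inner ℝ (d i) (d j) else 0

/-- Only edges leaving `P` change, each by the product of the two differences. The doubled sum runs
over ordered pairs, hence meets such an edge in both orientations. -/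
lemma surplus_mix_add_surplus_mix (H : VGraph ι) (P : Set ι) (x y : ι → 𝔼) :
    surplus H (mix P x y) + surplus H (mix P y x) =
      surplus H x + surplus H y - crossSum H P (y - x) := by
  classical
  have hswap : crossSum H P (y - x) = ∑ i, ∑ j, if H.Adj i j ∧ i ∉ P ∧ j ∈ P then
      inner ℝ ((y - x) i) ((y - x) j) else 0 := by
    rw [crossSum, Finset.sum_comm]
    refine Finset.sum_congr rfl fun i _ => Finset.sum_congr rfl fun j _ => ?_
    rw [H.adj_comm, real_inner_comm]
    simp only [and_comm (a := j ∈ P)]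
  have h : 2 * surplus H (mix P x y) + 2 * surplus H (mix P y x) + crossSum H P (y - x) +
      crossSum H P (y - x) = 2 * surplus H x + 2 * surplus H y := by
    nth_rewrite 2 [hswap]
    simp only [two_mul_surplus, crossSum, ← Finset.sum_add_distrib]
    refine Finset.sum_congr rfl fun i _ => Finset.sum_congr rfl fun j _ => ?_
    by_cases hij : H.Adj i j
    · by_cases hi : i ∈ P <;> by_cases hj : j ∈ P <;>
        simp [hij, hi, hj, mix, inner_sub_left, inner_sub_right] <;> ring
    · simp [hij]
  linarith

lemma surplus_update [DecidableEq ι] (H : VGraph ι) (x : ι → 𝔼) (i : ι) (t : 𝔼) :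
    surplus H (Function.update x i t) = surplus H x + inner ℝ (nbrSum H x i) (t - x i) := by
  classical
  have h1 : inner ℝ (nbrSum H x i) (t - x i) =
      ∑ k, ∑ j, if k = i ∧ H.Adj i j then inner ℝ (x j) (t - x i) else 0 := by
    rw [Finset.sum_eq_single i (fun k _ hk => by simp [hk]) (by simp), nbrSum, sum_inner]
    refine Finset.sum_congr rfl fun j _ => ?_
    by_cases h : H.Adj i j <;> simp [h]
  have h2 : inner ℝ (nbrSum H x i) (t - x i) =
      ∑ j, ∑ k, if k = i ∧ H.Adj i j then inner ℝ (x j) (t - x i) else 0 := by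
    rw [h1, Finset.sum_comm]
  have h : 2 * surplus H (Function.update x i t) = 2 * surplus H x +
      inner ℝ (nbrSum H x i) (t - x i) + inner ℝ (nbrSum H x i) (t - x i) := by
    nth_rewrite 1 [h1]
    rw [h2]
    simp only [two_mul_surplus, ← Finset.sum_add_distrib]
    refine Finset.sum_congr rfl fun k _ => Finset.sum_congr rfl fun j _ => ?_
    by_cases hk : k = i
    · subst hk
      by_cases hj : j = k
      · subst hj
        have ha : ¬ H.Adj j j := fun h => h.ne rfl
        simp [ha]
      · by_cases ha : H.Adj k j
        · simp [ha, hj, inner_sub_right, real_inner_comm]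
        · simp [ha, hj]
    · by_cases hj : j = i
      · subst hj
        by_cases ha : H.Adj k j
        · simp [ha, ha.symm, hk, inner_sub_right]
        · have ha' : ¬ H.Adj j k := fun h => ha h.symm
          simp [ha, ha', hk]
      · simp [hk, hj]
  linarith

lemma IsCyclicallyMonotone.chain_le {H : VGraph ι} {Γ : Set (ι → 𝔼)}
    (h : IsCyclicallyMonotone (surplus H) Γ) (i : ι) {p₀ p : 𝔼 × 𝔼} {c : ℝ}
    (hp₀ : p₀ ∈ (fun x => (x i, nbrSum H x i)) '' Γ)
    (hp : IsChainValue ((fun x => (x i, nbrSum H x i)) '' Γ) p₀ p c) :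
    c + inner ℝ p.2 (p₀.1 - p.1) ≤ 0 := by
  classical
  obtain ⟨x₀, hx₀, rfl⟩ := hp₀
  -- Each chain point receives the `i`-th coordinate of its successor, and the last one that of
  -- `x₀`. As the surplus is affine in this coordinate, `c` is the gain made before the last
  -- replacement; closing the chain makes the whole a rearrangement.
  have key : ∃ x ∈ Γ, p = (x i, nbrSum H x i) ∧ ∃ K K' : Multiset (ι → 𝔼),
      (∀ y ∈ K, y ∈ Γ) ∧ SameMarginals (x ::ₘ K) (Function.update x i (x₀ i) ::ₘ K') ∧
      c + (K.map (surplus H)).sum = (K'.map (surplus H)).sum := by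
    induction hp with
    | start => exact ⟨x₀, hx₀, rfl, 0, 0, by simp, by simp [SameMarginals], by simp⟩
    | @step p c q _ hq ih =>
      obtain ⟨x, hx, rfl, K, K', hK, hKK, hs⟩ := ih
      obtain ⟨y, hy, rfl⟩ := hq
      refine ⟨y, hy, rfl, x ::ₘ K, Function.update x i (y i) ::ₘ K', ?_, fun j => ?_, ?_⟩
      · simpa using ⟨hx, hK⟩
      · have h1 := hKK j
        by_cases hj : j = i
        · subst hj
          simp only [Multiset.map_cons, Function.update_self] at h1 ⊢
          rw [h1, Multiset.cons_swap]
        · simp only [Multiset.map_cons, Function.update_of_ne hj] at h1 ⊢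
          rw [h1]
      · simp only [Multiset.map_cons, Multiset.sum_cons, surplus_update]
        linarith
  obtain ⟨x, hx, rfl, K, K', hK, hKK, hs⟩ := key
  have := h _ _ (by simpa using ⟨hx, hK⟩) hKK
  simp only [Multiset.map_cons, Multiset.sum_cons, surplus_update] at this
  simp only
  linarith

/-- The first order condition: outside of a null set, the value of `x i` determines the sum of
`x j` over the neighbours `j` of `i`. -/
theorem IsCyclicallyMonotone.exists_null {H : VGraph ι} {Γ : Set (ι → 𝔼)}
    (h : IsCyclicallyMonotone (surplus H) Γ) {R : ℝ} (hR : ∀ x ∈ Γ, ∀ i, ‖x i‖ ≤ R) (i : ι) :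
    ∃ N : Set 𝔼, MeasurableSet N ∧ volume N = 0 ∧
      ∀ x ∈ Γ, ∀ y ∈ Γ, x i = y i → x i ∉ N → nbrSum H x i = nbrSum H y i := by
  classical
  obtain ⟨N, hN, hN0, hNe⟩ := exists_null_forall_eq (volume : Measure 𝔼)
    (S := (fun x => (x i, nbrSum H x i)) '' Γ) (R := ∑ _j : ι, |R|)
    (by
      rintro _ ⟨x, hx, rfl⟩
      refine (norm_sum_le _ _).trans (Finset.sum_le_sum fun j _ => ?_)
      split_ifs
      · exact (hR x hx j).trans (le_abs_self R)
      · simp)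
    (fun p₀ hp₀ p c hp => h.chain_le i hp₀ hp)
  exact ⟨N, hN, hN0, fun x hx y hy hxy hxN =>
    hNe _ ⟨x, hx, rfl⟩ _ ⟨y, hy, rfl⟩ hxy hxN⟩

end Surplus

/-! ### Separation in forests -/

section Tree

variable {κ : Type*} {T : SimpleGraph κ}

lemma deleteIncidenceSet_adj_of_ne {l a b : κ} (h : T.Adj a b) (ha : a ≠ l) (hb : b ≠ l) :
    (T.deleteIncidenceSet l).Adj a b :=
  T.deleteIncidenceSet_adj.2 ⟨h, ha, hb⟩

lemma ne_of_reachable_deleteIncidenceSet {l a b : κ}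
    (h : (T.deleteIncidenceSet l).Reachable a b) (ha : a ≠ l) : b ≠ l := by
  rintro rfl
  obtain ⟨w⟩ := h.symm
  cases w with
  | nil => exact ha rfl
  | cons h _ => exact (T.deleteIncidenceSet_adj.1 h).2.1 rfl

/-- In a forest, distinct neighbours of a vertex are separated by it. -/
lemma eq_of_reachable_deleteIncidenceSet (hT : T.IsAcyclic) {l a b : κ} (ha : T.Adj l a)
    (hb : T.Adj l b) (h : (T.deleteIncidenceSet l).Reachable a b) : a = b := by
  by_contra hab
  have hbr := SimpleGraph.isBridge_iff.1 (SimpleGraph.isAcyclic_iff_forall_adj_isBridge.1 hT ha)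
  -- A path from `b` to `a` avoiding `l`, preceded by the edge `lb`, would bypass the bridge `la`.
  have hle : T.deleteIncidenceSet l ≤ T.deleteEdges {s(l, a)} := by
    intro c e hce
    obtain ⟨h1, h2, h3⟩ := T.deleteIncidenceSet_adj.1 hce
    rw [SimpleGraph.deleteEdges_adj]
    refine ⟨h1, fun h4 => ?_⟩
    rcases Sym2.eq_iff.1 h4 with h5 | h5
    exacts [h2 h5.1, h3 h5.2]
  have h1 : (T.deleteEdges {s(l, a)}).Adj l b := by
    rw [SimpleGraph.deleteEdges_adj]
    refine ⟨hb, fun h4 => ?_⟩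
    rcases Sym2.eq_iff.1 h4 with h5 | h5
    exacts [hab h5.2.symm, hb.ne h5.2.symm]
  exact hbr (h1.reachable.trans (h.symm.mono hle))

lemma not_adj_of_adj_of_adj (hT : T.IsAcyclic) {l a b : κ} (ha : T.Adj l a) (hb : T.Adj l b) :
    ¬ T.Adj a b := fun h =>
  h.ne (eq_of_reachable_deleteIncidenceSet hT ha hb
    (deleteIncidenceSet_adj_of_ne h ha.ne' hb.ne').reachable)

end Tree

/-! ### Maximal cliques, hubs and branches -/

section Hub

variable {ι : Type*} {H : VGraph ι} {A S T : Set ι}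

lemma IsMaximalClique.subset_verts (h : IsMaximalClique H S) : S ⊆ H.verts := h.1.1

lemma IsMaximalClique.adj (h : IsMaximalClique H S) {i j : ι} (hi : i ∈ S) (hj : j ∈ S)
    (hij : i ≠ j) : H.Adj i j := h.1.2 hi hj hij

lemma exists_isMaximalClique_superset [Finite ι] (hT : T ⊆ H.verts) (hT' : T.Pairwise H.Adj) :
    ∃ S, IsMaximalClique H S ∧ T ⊆ S := by
  obtain ⟨S, hTS, hS⟩ := (Set.toFinite
    {U : Set ι | U ⊆ H.verts ∧ U.Pairwise H.Adj}).exists_le_maximal ⟨hT, hT'⟩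
  exact ⟨S, hS, hTS⟩

lemma exists_isMaximalClique_of_mem [Finite ι] {i : ι} (hi : i ∈ H.verts) :
    ∃ S, IsMaximalClique H S ∧ i ∈ S := by
  obtain ⟨S, hS, h⟩ := exists_isMaximalClique_superset (H := H) (T := {i}) (by simpa using hi)
    (Set.pairwise_singleton _ _)
  exact ⟨S, hS, by simpa using h⟩

lemma exists_isMaximalClique_of_adj [Finite ι] {i j : ι} (hij : H.Adj i j) :
    ∃ S, IsMaximalClique H S ∧ i ∈ S ∧ j ∈ S := by
  obtain ⟨S, hS, h⟩ := exists_isMaximalClique_superset (H := H) (T := {i, j})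
    (Set.insert_subset hij.fst_mem (by simpa using hij.snd_mem))
    (Set.pairwise_pair.2 fun _ => ⟨hij, hij.symm⟩)
  exact ⟨S, hS, h (by simp), h (by simp)⟩

lemma IsInnerHub.subset [Finite ι] (h : IsInnerHub H A) (hS : IsMaximalClique H S) : A ⊆ S := by
  by_cases hT : ∃ T, IsMaximalClique H T ∧ S ≠ T
  · obtain ⟨T, hT, hne⟩ := hT
    exact h.2.1 S T hS hT hne ▸ Set.inter_subset_left
  · push Not at hT
    have hv : S = H.verts := hS.subset_verts.antisymm fun v hv => by
      obtain ⟨T, hT', hvT⟩ := exists_isMaximalClique_of_mem hv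
      rwa [hT T hT']
    rw [h.2.2 (hv ▸ hS), hv]

lemma IsInnerHub.eq (h : IsInnerHub H A) (hS : IsMaximalClique H S) (hT : IsMaximalClique H T)
    {i : ι} (hiS : i ∈ S) (hiT : i ∈ T) (hi : i ∉ A) : S = T := by
  by_contra hne
  exact hi (h.2.1 S T hS hT hne ▸ ⟨hiS, hiT⟩)

end Hub

lemma isMaximalClique_of_adj {ι κ : Type*} {G : κ → VGraph ι} {α β : κ}
    (h : (gluingGraph G).Adj α β) :
    IsMaximalClique (G α) ((G α).verts ∩ (G β).verts) := by
  obtain ⟨-, S, h1, -, h3⟩ := h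
  rwa [h3]

/-- The vertices that are separated by the hub of `G α` from the other maximal cliques of `G α`,
on the side of the maximal clique `S`. -/
def branch {ι κ : Type*} (G : κ → VGraph ι) (A : κ → Set ι) (α : κ) (S : Set ι) : Set ι :=
  {i | i ∉ A α ∧ (i ∈ S ∨ ∃ ν β, (gluingGraph G).Adj α ν ∧ (G α).verts ∩ (G ν).verts = S ∧
    ((gluingGraph G).deleteIncidenceSet α).Reachable ν β ∧ i ∈ (G β).verts)}

/-- A family of graphs with pairwise disjoint inner hubs that are glued on cliques along a tree. -/
structure IsGluedTree {ι κ : Type*} (G : κ → VGraph ι) (A : κ → Set ι) : Prop where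
  hub : ∀ α, IsInnerHub (G α) (A α)
  nonempty : ∀ α, (A α).Nonempty
  disj : ∀ α β, α ≠ β → A α ∩ A β = ∅
  inter : ∀ α β, α ≠ β →
      (G α).verts ∩ (G β).verts = ∅ ∨
      (∃ S, IsMaximalClique (G α) S ∧ IsMaximalClique (G β) S ∧
        (G α).verts ∩ (G β).verts = S) ∨
      (∃ γ, γ ≠ α ∧ γ ≠ β ∧ (G α).verts ∩ (G β).verts = A γ)
  tree : (gluingGraph G).IsTree

namespace IsGluedTree

variable {ι κ : Type*} {G : κ → VGraph ι} {A : κ → Set ι}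


lemma hub_unique (hG : IsGluedTree G A) {α β : κ} {i : ι} (hα : i ∈ A α) (hβ : i ∈ A β) :
    α = β := by
  by_contra h
  exact (hG.disj α β h).subset ⟨hα, hβ⟩

lemma hub_subset_inter [Finite ι] (hG : IsGluedTree G A) {α β : κ} (h : (gluingGraph G).Adj α β) :
    A α ⊆ (G α).verts ∩ (G β).verts :=
  (hG.hub α).subset (isMaximalClique_of_adj h)

/-- If the intersection is a hub `A l`, this nonempty set lies in both graphs. Disjointness of the
hubs rules out that `G l` meets either of them in yet another hub, so it is glued to both. -/
lemma adj_or (hG : IsGluedTree G A) {α β : κ} (hne : α ≠ β) {i : ι}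
    (hα : i ∈ (G α).verts) (hβ : i ∈ (G β).verts) :
    (gluingGraph G).Adj α β ∨ ∃ l, (gluingGraph G).Adj l α ∧ (gluingGraph G).Adj l β ∧
      (G α).verts ∩ (G β).verts = A l := by
  rcases hG.inter α β hne with h | ⟨S, h⟩ | ⟨l, hlα, hlβ, h⟩
  · exact absurd (h.subset ⟨hα, hβ⟩) (Set.notMem_empty i)
  · exact .inl ⟨hne, S, h⟩
  · have key : ∀ δ, l ≠ δ → A l ⊆ (G δ).verts → (gluingGraph G).Adj l δ := by
      intro δ hδ hsub
      obtain ⟨j, hj⟩ := hG.nonempty l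
      rcases hG.inter l δ hδ with h' | ⟨S, h'⟩ | ⟨m, hm, -, h'⟩
      · exact absurd (h'.subset ⟨(hG.hub l).1 hj, hsub hj⟩) (Set.notMem_empty j)
      · exact ⟨hδ, S, h'⟩
      · exact absurd (hG.hub_unique (h'.subset ⟨(hG.hub l).1 hj, hsub hj⟩) hj) hm
    exact .inr ⟨l, key α hlα (h ▸ Set.inter_subset_left), key β hlβ (h ▸ Set.inter_subset_right),
      h⟩

lemma adj_of_mem_hub [Finite ι] (hG : IsGluedTree G A) {α β : κ} (hne : α ≠ β) {i : ι}
    (hα : i ∈ A α) (hβ : i ∈ (G β).verts) :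
    (gluingGraph G).Adj α β := by
  rcases hG.adj_or hne ((hG.hub α).1 hα) hβ with h | ⟨l, hl, -, h⟩
  · exact h
  · exact absurd (hG.hub_unique (h.subset ⟨(hG.hub α).1 hα, hβ⟩) hα) hl.ne

/-- A hub vertex lies in every maximal clique of its graph. In any other graph it is not in the hub,
so all its edges there stay in the clique shared with `G α`. -/
lemma sup_adj_iff_of_mem_hub [Finite ι] (hG : IsGluedTree G A) {α : κ} {i j : ι} (hi : i ∈ A α) :
    (⨆ β, G β).Adj i j ↔ j ∈ (G α).verts ∧ i ≠ j := by
  rw [SimpleGraph.Subgraph.iSup_adj]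
  constructor
  · rintro ⟨β, hij⟩
    refine ⟨?_, hij.ne⟩
    rcases eq_or_ne α β with rfl | hne
    · exact hij.snd_mem
    have hadj := hG.adj_of_mem_hub hne hi hij.fst_mem
    obtain ⟨S, hS, hiS, hjS⟩ := exists_isMaximalClique_of_adj hij
    have := (hG.hub β).eq hS (isMaximalClique_of_adj hadj.symm) hiS
      ⟨hij.fst_mem, (hG.hub α).1 hi⟩ fun h => hne (hG.hub_unique hi h)
    exact (this.subset hjS).2
  · rintro ⟨hj, hij⟩
    obtain ⟨S, hS, hjS⟩ := exists_isMaximalClique_of_mem hj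
    exact ⟨α, hS.adj ((hG.hub α).subset hS hi) hjS hij⟩

/-- Outside all hubs a vertex lies in just one maximal clique of each graph containing it, and two
such graphs can only be glued on that clique. -/
lemma sup_adj_iff_of_notMem_hub [Finite ι] (hG : IsGluedTree G A) {α : κ} {S : Set ι}
    (hS : IsMaximalClique (G α) S) {i j : ι}
    (hi : i ∈ S) (hi' : ∀ β, i ∉ A β) : (⨆ β, G β).Adj i j ↔ j ∈ S ∧ i ≠ j := by
  rw [SimpleGraph.Subgraph.iSup_adj]
  constructor
  · rintro ⟨β, hij⟩
    refine ⟨?_, hij.ne⟩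
    obtain ⟨T, hT, hiT, hjT⟩ := exists_isMaximalClique_of_adj hij
    rcases eq_or_ne α β with rfl | hne
    · rwa [(hG.hub α).eq hS hT hi hiT (hi' α)]
    have hiα := hS.subset_verts hi
    rcases hG.adj_or hne hiα hij.fst_mem with h | ⟨l, -, -, h⟩
    · have h1 := (hG.hub α).eq hS (isMaximalClique_of_adj h) hi ⟨hiα, hij.fst_mem⟩ (hi' α)
      have h2 := (hG.hub β).eq hT (isMaximalClique_of_adj h.symm) hiT ⟨hij.fst_mem, hiα⟩ (hi' β)
      rw [h1, Set.inter_comm, ← h2]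
      exact hjT
    · exact absurd (h.subset ⟨hiα, hij.fst_mem⟩) (hi' l)
  · rintro ⟨hj, hij⟩
    exact ⟨α, hS.adj hi hj hij⟩

/-- A component of the tree without `α` contains just one neighbour `ν` of `α`. A graph there meets
`G α` only if it is `G ν` or through the hub of `G ν`. -/
lemma mem_of_mem_branch [Finite ι] (hG : IsGluedTree G A) {α : κ} {S : Set ι} {i : ι}
    (hi : i ∈ branch G A α S)
    (hiα : i ∈ (G α).verts) : i ∈ S := by
  obtain ⟨-, h | ⟨ν, β, hν, rfl, hr, hβ⟩⟩ := hi
  · exact h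
  have hT := hG.tree.isAcyclic
  have hβα : β ≠ α := ne_of_reachable_deleteIncidenceSet hr hν.ne'
  rcases hG.adj_or hβα hβ hiα with h | ⟨l, hlβ, hlα, h⟩
  · rw [eq_of_reachable_deleteIncidenceSet hT hν h.symm hr]
    exact ⟨hiα, hβ⟩
  · have : ν = l := eq_of_reachable_deleteIncidenceSet hT hν hlα.symm
      (hr.trans (deleteIncidenceSet_adj_of_ne hlβ.symm hβα hlα.ne).reachable)
    subst this
    rw [Set.inter_comm]
    exact hG.hub_subset_inter hlα (h.subset ⟨hβ, hiα⟩)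

/-- An edge starting in the branch lies in `G α` or in a graph on the same side of `α`: passing to
the other side would require the starting vertex to lie in `A α`. -/
lemma mem_hub_of_adj_of_mem_branch [Finite ι] (hG : IsGluedTree G A) {α : κ} {S : Set ι}
    (hS : IsMaximalClique (G α) S) {i j : ι}
    (hi : i ∈ branch G A α S) (hj : j ∉ branch G A α S) (hij : (⨆ β, G β).Adj i j) :
    j ∈ A α := by
  by_contra hjA
  refine hj ⟨hjA, ?_⟩
  obtain ⟨β, hβ⟩ := SimpleGraph.Subgraph.iSup_adj.1 hij
  rcases eq_or_ne β α with rfl | hne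
  · obtain ⟨T, hT, hiT, hjT⟩ := exists_isMaximalClique_of_adj hβ
    left
    rwa [(hG.hub β).eq hS hT (hG.mem_of_mem_branch hi hβ.fst_mem) hiT hi.1]
  right
  obtain ⟨hiA, h | ⟨ν, δ, hν, hνS, hr, hδ⟩⟩ := hi
  · have hiα := hS.subset_verts h
    rcases hG.adj_or hne.symm hiα hβ.fst_mem with h' | ⟨l, hlα, hlβ, h'⟩
    · exact ⟨β, β, h', (hG.hub α).eq (isMaximalClique_of_adj h') hS ⟨hiα, hβ.fst_mem⟩ h hiA, .rfl,
        hβ.snd_mem⟩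
    · refine ⟨l, β, hlα.symm, (hG.hub α).eq (isMaximalClique_of_adj hlα.symm) hS ?_ h hiA,
        (deleteIncidenceSet_adj_of_ne hlβ hlα.ne hne).reachable, hβ.snd_mem⟩
      rw [Set.inter_comm]
      exact hG.hub_subset_inter hlα (h'.subset ⟨hiα, hβ.fst_mem⟩)
  · refine ⟨ν, β, hν, hνS, ?_, hβ.snd_mem⟩
    have hδα : δ ≠ α := ne_of_reachable_deleteIncidenceSet hr hν.ne'
    rcases eq_or_ne δ β with rfl | hδβ
    · exact hr
    rcases hG.adj_or hδβ hδ hβ.fst_mem with h' | ⟨l, hlδ, hlβ, h'⟩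
    · exact hr.trans (deleteIncidenceSet_adj_of_ne h' hδα hne).reachable
    · have hlα : l ≠ α := by
        rintro rfl
        exact hiA (h'.subset ⟨hδ, hβ.fst_mem⟩)
      exact (hr.trans (deleteIncidenceSet_adj_of_ne hlδ.symm hδα hlα).reachable).trans
        (deleteIncidenceSet_adj_of_ne hlβ hlα hne).reachable

end IsGluedTree

/-! ### Sums of differences over sets of vertices -/

section Sums

variable {ι : Type*} [Fintype ι] {n : ℕ}

local notation "𝔼" => EuclideanSpace ℝ (Fin n)

/-- The sum of `d i` over `i ∈ s`. -/
def setSum (s : Set ι) (d : ι → 𝔼) : 𝔼 := ∑ i, s.indicator d i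

lemma setSum_union {s t : Set ι} (h : Disjoint s t) (d : ι → 𝔼) :
    setSum (s ∪ t) d = setSum s d + setSum t d := by
  simp only [setSum, Set.indicator_union_of_disjoint h, Finset.sum_add_distrib]

lemma setSum_diff {s t : Set ι} (h : t ⊆ s) (d : ι → 𝔼) :
    setSum (s \ t) d = setSum s d - setSum t d := by
  rw [eq_sub_iff_add_eq, ← setSum_union Set.disjoint_sdiff_left, Set.sdiff_union_of_subset h]

lemma setSum_singleton (i : ι) (d : ι → 𝔼) : setSum {i} d = d i := by
  classical
  simp [setSum, Set.indicator_apply]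

lemma setSum_diff_singleton {s : Set ι} {i : ι} (h : i ∈ s) (d : ι → 𝔼) :
    setSum (s \ {i}) d = setSum s d - d i := by
  rw [setSum_diff (by simpa using h), setSum_singleton]

lemma setSum_eq_zero {s : Set ι} {d : ι → 𝔼} (h : ∀ i ∈ s, d i = 0) : setSum s d = 0 :=
  Finset.sum_eq_zero fun i _ => by
    by_cases hi : i ∈ s
    · rw [Set.indicator_of_mem hi, h i hi]
    · rw [Set.indicator_of_notMem hi]

lemma setSum_sub (s : Set ι) (x y : ι → 𝔼) : setSum s (y - x) = setSum s y - setSum s x := by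
  simp only [setSum, Set.indicator_sub', Pi.sub_apply, Finset.sum_sub_distrib]

variable {H : VGraph ι} {U : Set ι} {i : ι}

lemma nbrSum_eq_setSum_sub (hU : ∀ j, H.Adj i j ↔ j ∈ U ∧ i ≠ j) (hi : i ∈ U) (x : ι → 𝔼) :
    nbrSum H x i = setSum U x - x i := by
  classical
  rw [← setSum_diff_singleton hi, nbrSum, setSum]
  refine Finset.sum_congr rfl fun j _ => ?_
  simp [Set.indicator_apply, hU, eq_comm]

lemma setSum_sub_eq_zero (hU : ∀ j, H.Adj i j ↔ j ∈ U ∧ i ≠ j) (hi : i ∈ U) {x y : ι → 𝔼}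
    (hxy : x i = y i) (h : nbrSum H x i = nbrSum H y i) : setSum U (y - x) = 0 := by
  rw [nbrSum_eq_setSum_sub hU hi, nbrSum_eq_setSum_sub hU hi, hxy, sub_left_inj] at h
  rw [setSum_sub, h, sub_self]

/-- The sum over the edges leaving `P` when, up to terms that vanish, these join all of `B` to all
of `B'`. -/
lemma crossSum_eq_inner {P B B' : Set ι} {d : ι → 𝔼} (hB : B ⊆ P) (hB' : Disjoint B' P)
    (h : ∀ i ∈ P, ∀ j, j ∉ P → d i ≠ 0 → d j ≠ 0 → (H.Adj i j ↔ i ∈ B ∧ j ∈ B')) :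
    crossSum H P d = inner ℝ (setSum B d) (setSum B' d) := by
  classical
  simp only [crossSum, setSum, sum_inner]
  refine Finset.sum_congr rfl fun i _ => ?_
  rw [inner_sum]
  refine Finset.sum_congr rfl fun j _ => ?_
  by_cases hi : i ∈ P
  · by_cases hj : j ∈ P
    · have : j ∉ B' := fun hj' => hB'.le_bot ⟨hj', hj⟩
      simp [hj, this]
    · by_cases hdi : d i = 0
      · simp [Set.indicator_apply, hdi]
      by_cases hdj : d j = 0
      · simp [Set.indicator_apply, hdj]
      have := h i hi j hj hdi hdj
      by_cases hiB : i ∈ B <;> by_cases hjB : j ∈ B' <;> simp [hi, hj, this, hiB, hjB]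
  · have : i ∉ B := fun hi' => hi (hB hi')
    simp [hi, this]

lemma crossSum_singleton (hU : ∀ j, H.Adj i j ↔ j ∈ U ∧ i ≠ j) (hi : i ∈ U) (d : ι → 𝔼) :
    crossSum H {i} d = inner ℝ (d i) (setSum U d - d i) := by
  rw [← setSum_diff_singleton hi, ← setSum_singleton i d]
  refine crossSum_eq_inner le_rfl Set.disjoint_sdiff_left fun a ha j _ _ _ => ?_
  obtain rfl : a = i := ha
  simp [hU, eq_comm]

lemma eq_zero_of_crossSum_singleton_nonneg (hU : ∀ j, H.Adj i j ↔ j ∈ U ∧ i ≠ j) (hi : i ∈ U)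
    {d : ι → 𝔼} (h : 0 ≤ crossSum H {i} d) (h0 : setSum U d = 0) : d i = 0 := by
  rw [crossSum_singleton hU hi, h0, zero_sub, inner_neg_right, real_inner_self_eq_norm_sq] at h
  exact norm_eq_zero.1 (pow_eq_zero_iff two_ne_zero |>.1 (by nlinarith [sq_nonneg ‖d i‖]))

end Sums

/-! ### Propagation of zeros along the tree -/

namespace IsGluedTree

variable {ι κ : Type*} [Fintype ι] {n : ℕ} {G : κ → VGraph ι} {A : κ → Set ι}

local notation "𝔼" => EuclideanSpace ℝ (Fin n)

/-- Exchanging `i` alone loses `⟪d i, D - d i⟫`; exchanging `i` together with all branches other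
than that of `S` loses `⟪d i + D, -d i⟫`. Both are nonnegative, yet they add up to `-2 * ‖d i‖ ^ 2`.
-/
lemma eq_zero_on_hub_of_setSum_eq_zero (hG : IsGluedTree G A) {α : κ} {S : Set ι}
    (hS : IsMaximalClique (G α) S) {d : ι → 𝔼} (hd : ∀ P, 0 ≤ crossSum (⨆ β, G β) P d)
    (h0 : setSum S d = 0) (hSA : ∀ i ∈ S, i ∉ A α → d i = 0) {i : ι} (hi : i ∈ A α) :
    d i = 0 := by
  have hAS := (hG.hub α).subset hS
  have hSV := hS.subset_verts
  have hiV := hSV (hAS hi)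
  have hA0 : setSum (A α) d = 0 := by
    have := setSum_diff hAS d
    rw [h0, setSum_eq_zero fun j hj => hSA j hj.1 hj.2] at this
    simpa [eq_comm] using this
  set D := setSum ((G α).verts \ S) d with hD
  have hV : setSum (G α).verts d = D := by rw [hD, setSum_diff hSV, h0, sub_zero]
  have h1 : 0 ≤ inner ℝ (d i) (D - d i) := by
    rw [← hV, ← crossSum_singleton (fun j => hG.sup_adj_iff_of_mem_hub hi) hiV]
    exact hd _
  let Q : Set ι := {j | ∃ T, IsMaximalClique (G α) T ∧ T ≠ S ∧ j ∈ branch G A α T}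
  have hQS : ∀ j ∈ Q, j ∉ S := by
    rintro j ⟨T, hT, hTS, hj⟩ hjS
    exact hTS ((hG.hub α).eq hT hS (hG.mem_of_mem_branch hj (hSV hjS)) hjS hj.1)
  have hQA : ∀ j ∈ Q, j ∉ A α := by
    rintro j ⟨T, hT, hTS, hj⟩
    exact hj.1
  have hQV : ∀ j ∈ (G α).verts, j ∉ S → j ∈ Q := by
    intro j hj hjS
    obtain ⟨T, hT, hjT⟩ := exists_isMaximalClique_of_mem hj
    exact ⟨T, hT, fun h => hjS (h ▸ hjT), fun h => hjS (hAS h), .inl hjT⟩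
  have h2 : crossSum (⨆ β, G β) ({i} ∪ Q) d = inner ℝ (d i + D) (- d i) := by
    have hAi : setSum (A α \ {i}) d = - d i := by
      rw [setSum_diff_singleton hi, hA0, zero_sub]
    have hBi : setSum ({i} ∪ (G α).verts \ S) d = d i + D := by
      rw [setSum_union (Set.disjoint_singleton_left.2 fun h => h.2 (hAS hi)), setSum_singleton]
    rw [← hAi, ← hBi]
    refine crossSum_eq_inner ?_ ?_ fun a ha j hj _ hdj => ?_
    · exact Set.union_subset_union_right _ fun j hj => hQV j hj.1 hj.2
    · refine Set.disjoint_left.2 fun j hj hj' => ?_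
      rcases hj' with h | h
      exacts [hj.2 h, hQA j h hj.1]
    · have hji : j ≠ i := fun h => hj (.inl h)
      have hjQ : j ∉ Q := fun h => hj (.inr h)
      have haj : a ≠ j := fun h => hj (h ▸ ha)
      have hjA : j ∈ (G α).verts → j ∈ A α := fun hjV => by
        have hjS : j ∈ S := by_contra fun h => hjQ (hQV j hjV h)
        exact by_contra fun h => hdj (hSA j hjS h)
      have haV : a ∈ {i} ∪ (G α).verts \ S ↔ a ∈ (G α).verts := by
        constructor
        · rintro (h | h)
          · obtain rfl : a = i := h
            exact hiV
          · exact h.1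
        · intro h
          rcases ha with h' | h'
          exacts [.inl h', .inr ⟨h, hQS a h'⟩]
      rw [haV]
      constructor
      · intro hadj
        have hjA' : j ∈ A α := by
          rcases ha with rfl | ⟨T, hT, hTS, haT⟩
          · exact hjA ((hG.sup_adj_iff_of_mem_hub hi).1 hadj).1
          · exact hG.mem_hub_of_adj_of_mem_branch hT haT
              (fun h => hjQ ⟨T, hT, hTS, h⟩) hadj
        exact ⟨((hG.sup_adj_iff_of_mem_hub hjA').1 hadj.symm).1, hjA', hji⟩
      · rintro ⟨haV, hjA', -⟩
        exact ((hG.sup_adj_iff_of_mem_hub hjA').2 ⟨haV, haj.symm⟩).symm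
  have h3 := hd ({i} ∪ Q)
  rw [h2, inner_neg_right, inner_add_left] at h3
  rw [inner_sub_right, real_inner_comm] at h1
  have h4 : ‖d i‖ ^ 2 = 0 := by
    rw [real_inner_self_eq_norm_sq] at h1 h3
    nlinarith [sq_nonneg ‖d i‖]
  exact norm_eq_zero.1 (pow_eq_zero_iff two_ne_zero |>.1 h4)

/-- Along a glued tree, the coordinate at `v₁` determines all other ones on a set of points that
satisfies the second order monotonicity, is closed under exchanges with equality, and satisfies
the first order condition at `v₁` and at a vertex of each hub. -/
theorem injective_of_crossSum_nonneg (hG : IsGluedTree G A)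
    (hcover : (⨆ α, G α).verts = Set.univ) {W : Set (ι → 𝔼)}
    (hcross : ∀ x ∈ W, ∀ y ∈ W, ∀ P, 0 ≤ crossSum (⨆ α, G α) P (y - x))
    (hmix : ∀ x ∈ W, ∀ y ∈ W, ∀ P, crossSum (⨆ α, G α) P (y - x) = 0 → mix P x y ∈ W)
    {v₁ : ι} (hv₁ : ∀ x ∈ W, ∀ y ∈ W, x v₁ = y v₁ →
      nbrSum (⨆ α, G α) x v₁ = nbrSum (⨆ α, G α) y v₁)
    (hreg : ∀ α, ∃ p ∈ A α, ∀ x ∈ W, ∀ y ∈ W, x p = y p →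
      nbrSum (⨆ α, G α) x p = nbrSum (⨆ α, G α) y p)
    {α₁ : κ} {S₁ : Set ι} (hS₁ : IsMaximalClique (G α₁) S₁) (hvS₁ : v₁ ∈ S₁)
    (hfree : ∀ α, α ≠ α₁ → ¬ GluedOn (G α₁) (G α) S₁)
    {x y : ι → 𝔼} (hx : x ∈ W) (hy : y ∈ W) (hxy : x v₁ = y v₁) : x = y := by
  set H := ⨆ α, G α with hH
  set d := y - x with hd
  have hT := hG.tree.isAcyclic
  have hpos : ∀ P, 0 ≤ crossSum H P d := hcross x hx y hy
  have hadjA : ∀ {α i}, i ∈ A α → ∀ j, H.Adj i j ↔ j ∈ (G α).verts ∧ i ≠ j :=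
    fun hi j => hG.sup_adj_iff_of_mem_hub hi
  have hfreeZero : ∀ {α S}, IsMaximalClique (G α) S → setSum S d = 0 → ∀ i ∈ S,
      (∀ β, i ∉ A β) → d i = 0 := fun hS h0 i hi hiA =>
    eq_zero_of_crossSum_singleton_nonneg
      (fun j => hG.sup_adj_iff_of_notMem_hub hS hi hiA) hi (hpos _) h0
  have hclique : ∀ α, (∀ i ∈ A α, d i = 0) → ∀ S, IsMaximalClique (G α) S →
      setSum S d = 0 := by
    intro α hα S hS
    have hAS := (hG.hub α).subset hS
    -- Edges leaving the branch end in the hub, where `d = 0`, so this exchange is free. Within `G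
    -- α` the mixed point differs from `x` at most on `S \ A α`; the first order condition at `p`
    -- then makes `d` sum to zero there.
    have hm : mix (branch G A α S) x y ∈ W := by
      refine hmix x hx y hy _ (Finset.sum_eq_zero fun i _ => Finset.sum_eq_zero fun j _ => ?_)
      split_ifs with h
      · rw [← hd, hα j (hG.mem_hub_of_adj_of_mem_branch hS h.2.1 h.2.2 h.1), inner_zero_right]
      · rfl
    obtain ⟨p, hp, hpreg⟩ := hreg α
    have hpm : x p = mix (branch G A α S) x y p := (mix_of_notMem fun h => h.1 hp).symm
    have h1 := setSum_sub_eq_zero (hadjA hp) ((hG.hub α).1 hp) hpm (hpreg x hx _ hm hpm)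
    have h2 : setSum (G α).verts (mix (branch G A α S) x y - x) = setSum (S \ A α) d := by
      refine Finset.sum_congr rfl fun i _ => ?_
      classical
      simp only [Set.indicator_apply, Pi.sub_apply]
      by_cases hi : i ∈ (G α).verts
      · by_cases hiB : i ∈ branch G A α S
        · have hiS : i ∈ S \ A α := ⟨hG.mem_of_mem_branch hiB hi, hiB.1⟩
          rw [if_pos hi, if_pos hiS, mix_of_mem hiB]
          rfl
        · have hiS : i ∉ S \ A α := fun h => hiB ⟨h.2, .inl h.1⟩
          rw [if_pos hi, if_neg hiS, mix_of_notMem hiB, sub_self]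
      · have hiS : i ∉ S \ A α := fun h => hi (hS.subset_verts h.1)
        rw [if_neg hi, if_neg hiS]
    rw [h2, setSum_diff hAS, setSum_eq_zero hα, sub_zero] at h1
    exact h1
  have hstep : ∀ α β, (gluingGraph G).Adj α β → (∀ i ∈ A α, d i = 0) → ∀ i ∈ A β, d i = 0 := by
    intro α β hαβ hα i hi
    have hS := isMaximalClique_of_adj hαβ
    have hS' := isMaximalClique_of_adj hαβ.symm
    have h0 := hclique α hα _ hS
    refine hG.eq_zero_on_hub_of_setSum_eq_zero hS' hpos (by rwa [Set.inter_comm]) ?_ hi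
    rintro j ⟨hjβ, hjα⟩ hj
    -- A third hub through `j` would make `m`, `α`, `β` a triangle in the tree.
    by_cases hjA : ∃ m, j ∈ A m
    · obtain ⟨m, hm⟩ := hjA
      rcases eq_or_ne m α with rfl | hmα
      · exact hα j hm
      have hmβ : m ≠ β := by rintro rfl; exact hj hm
      exact absurd hαβ (not_adj_of_adj_of_adj hT (hG.adj_of_mem_hub hmα hm hjα)
        (hG.adj_of_mem_hub hmβ hm hjβ))
    · push Not at hjA
      exact hfreeZero hS h0 j ⟨hjα, hjβ⟩ hjA
  have hbase : ∃ α, ∀ i ∈ A α, d i = 0 := by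
    -- If `v₁` is in a hub, all vertices of that hub share its closed neighbourhood, so its zero sum
    -- settles them at once.
    by_cases hvA : ∃ m, v₁ ∈ A m
    · obtain ⟨m, hm⟩ := hvA
      have h0 := setSum_sub_eq_zero (hadjA hm) ((hG.hub m).1 hm) hxy (hv₁ x hx y hy hxy)
      exact ⟨m, fun i hi => eq_zero_of_crossSum_singleton_nonneg (hadjA hi) ((hG.hub m).1 hi)
        (hpos _) h0⟩
    · push Not at hvA
      have h0 := setSum_sub_eq_zero (fun j => hG.sup_adj_iff_of_notMem_hub hS₁ hvS₁ hvA) hvS₁ hxy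
        (hv₁ x hx y hy hxy)
      refine ⟨α₁, fun i hi => hG.eq_zero_on_hub_of_setSum_eq_zero hS₁ hpos h0 ?_ hi⟩
      intro j hjS hj
      -- A vertex of `S₁` in another hub `A m` would force `G m` to be glued to `G α₁` on `S₁`.
      by_cases hjA : ∃ m, j ∈ A m
      · obtain ⟨m, hm⟩ := hjA
        have hmα : m ≠ α₁ := by rintro rfl; exact hj hm
        have hjα := hS₁.subset_verts hjS
        have hadj := hG.adj_of_mem_hub hmα hm hjα
        have hS := isMaximalClique_of_adj hadj.symm
        have := (hG.hub α₁).eq hS hS₁ ⟨hjα, (hG.hub m).1 hm⟩ hjS hj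
        exact absurd ⟨hS₁, by rw [← this, Set.inter_comm]; exact isMaximalClique_of_adj hadj,
          this⟩ (hfree m hmα)
      · push Not at hjA
        exact hfreeZero hS₁ h0 j hjS hjA
  have hall : ∀ α, ∀ i ∈ A α, d i = 0 := by
    obtain ⟨β, hβ⟩ := hbase
    intro α
    obtain ⟨w⟩ := hG.tree.connected.preconnected β α
    induction w with
    | nil => exact hβ
    | cons h _ ih => exact ih (hstep _ _ h hβ)
  funext i
  suffices d i = 0 from (sub_eq_zero.1 this).symm
  by_cases hiA : ∃ m, i ∈ A m
  · obtain ⟨m, hm⟩ := hiA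
    exact hall m i hm
  · push Not at hiA
    have hi : i ∈ H.verts := hcover ▸ Set.mem_univ i
    rw [hH, SimpleGraph.Subgraph.verts_iSup, Set.mem_iUnion] at hi
    obtain ⟨α, hα⟩ := hi
    obtain ⟨S, hS, hiS⟩ := exists_isMaximalClique_of_mem hα
    exact hfreeZero hS (hclique α (hall α) S hS) i hiS hiA

end IsGluedTree

/-! ### From injectivity to a map -/

section Map

variable {ι : Type*} [Fintype ι] {n : ℕ}

local notation "𝔼" => EuclideanSpace ℝ (Fin n)

/-- A plan concentrated on a Borel set on which the coordinate at `v₁` is injective is induced by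
a map. -/
theorem IsTransportPlan.isInducedByMap {X : ι → Set 𝔼} {μ : ι → Measure 𝔼}
    {γ : Measure (ι → 𝔼)} (hγ : IsTransportPlan X μ γ) {v₁ : ι} {W : Set (ι → 𝔼)}
    (hW : MeasurableSet W) (hγW : γ Wᶜ = 0) (hWX : W ⊆ Set.univ.pi X)
    (hinj : Set.InjOn (fun x : ι → 𝔼 => x v₁) W) : IsInducedByMap X μ v₁ γ := by
  classical
  have hγp := hγ.1
  have hcont : ContinuousOn (fun x : ι → 𝔼 => x v₁) W := (continuous_apply v₁).continuousOn
  -- The Lusin–Souslin theorem: an injective continuous image of a Borel set is Borel.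
  have hV := hW.image_of_continuousOn_injOn hcont hinj
  set V := (fun x : ι → 𝔼 => x v₁) '' W with hVdef
  obtain ⟨g, hg, hgW⟩ := (hcont.measurableEmbedding hW hinj).exists_measurable_extend
    (g := Subtype.val) measurable_subtype_coe (fun _ => inferInstance)
  have hgW : ∀ x ∈ W, g (x v₁) = x := fun x hx => congrFun hgW ⟨x, hx⟩
  obtain ⟨c, hc⟩ : (Set.univ.pi X).Nonempty := by
    by_contra hne
    have h1 : γ (Set.univ.pi X)ᶜ = 1 := by
      rw [Set.not_nonempty_iff_eq_empty.1 hne, Set.compl_empty, measure_univ]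
    exact one_ne_zero (h1.symm.trans hγ.2.1)
  -- Off `V` the values are constrained only by `T v₁ = id` and by the targets `X i`; hence the
  -- identity at `v₁` and a fixed point `c` of the product elsewhere.
  let T : ι → 𝔼 → 𝔼 := fun i t => if t ∈ V then g t i else if i = v₁ then t else c i
  have hTm : ∀ i, Measurable (T i) := fun i =>
    Measurable.ite hV ((measurable_pi_apply i).comp hg)
      (Measurable.ite (.const _) measurable_id measurable_const)
  have hTW : ∀ x ∈ W, (fun i => T i (x v₁)) = x := fun x hx => by
    funext i
    have : x v₁ ∈ V := ⟨x, hx, rfl⟩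
    simp only [T, if_pos this, hgW x hx]
  have hmeas : ∀ i : ι, Measurable (fun x : ι → 𝔼 => x i) := measurable_pi_apply
  have hTm' : Measurable fun t i => T i t := measurable_pi_lambda _ hTm
  have hae : (fun x : ι → 𝔼 => fun i => T i (x v₁)) =ᵐ[γ] id := by
    have : ∀ᵐ x ∂γ, x ∈ W := hγW
    filter_upwards [this] with x hx using hTW x hx
  have hmap : (μ v₁).map (fun t i => T i t) = γ := by
    rw [← hγ.2.2 v₁, Measure.map_map hTm' (hmeas v₁)]
    exact (Measure.map_congr hae).trans Measure.map_id
  refine ⟨T, hTm, fun i t ht => ?_, ?_, fun i => ?_, hmap.symm⟩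
  · by_cases htV : t ∈ V
    · obtain ⟨x, hx, rfl⟩ := htV
      rw [show T i (x v₁) = x i from congrFun (hTW x hx) i]
      exact hWX hx i (Set.mem_univ i)
    · simp only [T, if_neg htV]
      split_ifs with h
      · exact h ▸ ht
      · exact hc i (Set.mem_univ i)
  · funext t
    by_cases htV : t ∈ V
    · obtain ⟨x, hx, rfl⟩ := htV
      exact congrFun (hTW x hx) v₁
    · simp [T, htV]
  · rw [← hγ.2.2 i, ← hmap, Measure.map_map (hmeas i) hTm']
    rfl

end Map

end GraphOT

end

/-! ### Conclusion -/

theorem proposition4p3 {ι κ : Type*} [Finite ι] [Finite κ] {n : ℕ}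
    (v₁ : ι) (α₁ : κ)
    -- the graphs, their inner hubs, and the union being a graph on all the vertices
    (G : κ → GraphOT.VGraph ι) (A : κ → Set ι)
    (hhub : ∀ α, GraphOT.IsInnerHub (G α) (A α))
    (hcover : (⨆ α, G α).verts = Set.univ)
    (hv₁ : v₁ ∈ (G α₁).verts)
    -- the domains and the marginals
    (X : ι → Set (EuclideanSpace ℝ (Fin n)))
    (hXo : ∀ i, IsOpen (X i)) (hXb : ∀ i, Bornology.IsBounded (X i))
    (μ : ι → MeasureTheory.Measure (EuclideanSpace ℝ (Fin n)))
    (hμp : ∀ i, MeasureTheory.IsProbabilityMeasure (μ i))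
    (hμX : ∀ i, μ i (X i)ᶜ = 0)
    -- hubs and intersections
    (hdisj : ∀ α β, α ≠ β → A α ∩ A β = ∅)
    (hinter : ∀ α β, α ≠ β →
      (G α).verts ∩ (G β).verts = ∅ ∨
      (∃ S, GraphOT.IsMaximalClique (G α) S ∧ GraphOT.IsMaximalClique (G β) S ∧
        (G α).verts ∩ (G β).verts = S) ∨
      (∃ γ, γ ≠ α ∧ γ ≠ β ∧ (G α).verts ∩ (G β).verts = A γ))
    -- regularity of the marginals
    (hac₁ : (μ v₁).AbsolutelyContinuous MeasureTheory.volume)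
    (hac : ∀ α, ∃ p ∈ A α, (μ p).AbsolutelyContinuous MeasureTheory.volume)
    -- a maximal clique through the first vertex on which nothing is glued to its graph
    (hfree : ∃ S, GraphOT.IsMaximalClique (G α₁) S ∧ v₁ ∈ S ∧
      ∀ α, α ≠ α₁ → ¬ GraphOT.GluedOn (G α₁) (G α) S)
    (htree : (GraphOT.gluingGraph G).IsTree) :
    ∀ π : MeasureTheory.Measure (ι → EuclideanSpace ℝ (Fin n)),
      GraphOT.IsKantorovichSolution X μ (GraphOT.surplus (⨆ α, G α)) π →
      GraphOT.IsInducedByMap X μ v₁ π := by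
  intro π hπ
  cases nonempty_fintype ι
  have : Nonempty ι := ⟨v₁⟩
  have hG : GraphOT.IsGluedTree G A :=
    ⟨hhub, fun α => (hac α).imp fun _ h => h.1, hdisj, hinter, htree⟩
  obtain ⟨S₁, hS₁, hvS₁, hS₁free⟩ := hfree
  set b := GraphOT.surplus (n := n) (⨆ α, G α) with hb
  set Γ := π.support ∩ Set.univ.pi X with hΓ
  have hcm := ((hπ.isCyclicallyMonotone_support hXo hXb hμX
    (GraphOT.continuous_surplus _)).mono (Γ' := Γ) Set.inter_subset_left).optimalHull
  choose R hR using fun i => (hXb i).exists_norm_le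
  have hbdd : ∀ x ∈ GraphOT.optimalHull b Γ, ∀ i, ‖x i‖ ≤ ∑ j, |R j| := by
    intro x hx i
    obtain ⟨y, hy, hyx⟩ := GraphOT.exists_apply_eq_of_mem_optimalHull hx i
    rw [← hyx]
    exact ((hR i _ (hy.2 i (Set.mem_univ i))).trans (le_abs_self _)).trans
      (Finset.single_le_sum (f := fun j => |R j|) (fun j _ => abs_nonneg _) (Finset.mem_univ i))
  choose N hNm hN0 hN using hcm.exists_null hbdd
  set I : Set ι := {i | (μ i).AbsolutelyContinuous volume} with hI
  -- Only indices with absolutely continuous marginal are used, so that `O` has full measure. The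
  -- condition is coordinatewise, hence preserved by `mix`.
  set O : Set (ι → EuclideanSpace ℝ (Fin n)) := {x | ∀ i ∈ I, x i ∉ N i} with hO
  have hreg : ∀ i ∈ I, ∀ x ∈ GraphOT.optimalHull b Γ ∩ O, ∀ y ∈ GraphOT.optimalHull b Γ ∩ O,
      x i = y i → GraphOT.nbrSum (⨆ α, G α) x i = GraphOT.nbrSum (⨆ α, G α) y i :=
    fun i hi x hx y hy hxy => hN i x hx.1 y hy.1 hxy (hx.2 i hi)
  have hinj : Set.InjOn (fun x : ι → EuclideanSpace ℝ (Fin n) => x v₁) (Γ ∩ O) := by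
    intro x hx y hy hxy
    refine hG.injective_of_crossSum_nonneg hcover (W := GraphOT.optimalHull b Γ ∩ O) ?_ ?_
      (hreg v₁ hac₁) (fun α => ?_) hS₁ hvS₁ hS₁free
      ⟨GraphOT.subset_optimalHull _ _ hx.1, hx.2⟩ ⟨GraphOT.subset_optimalHull _ _ hy.1, hy.2⟩ hxy
    · intro x hx y hy P
      have h1 := hcm.mix_le hx.1 hy.1 P
      rw [GraphOT.surplus_mix_add_surplus_mix] at h1
      linarith
    · intro x hx y hy P h0
      refine ⟨GraphOT.mix_mem_optimalHull hx.1 hy.1 ?_, fun i hi => ?_⟩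
      · rw [hb, GraphOT.surplus_mix_add_surplus_mix, h0, sub_zero]
      · by_cases hP : i ∈ P
        · rw [GraphOT.mix_of_mem hP]; exact hy.2 i hi
        · rw [GraphOT.mix_of_notMem hP]; exact hx.2 i hi
    · obtain ⟨p, hp, hpac⟩ := hac α
      exact ⟨p, hp, hreg p hpac⟩
  have hOm : MeasurableSet O := by
    have : O = ⋂ i ∈ I, (fun x : ι → EuclideanSpace ℝ (Fin n) => x i) ⁻¹' (N i)ᶜ := by
      ext x; simp [hO]
    rw [this]
    exact MeasurableSet.biInter (Set.to_countable I) fun i _ =>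
      measurable_pi_apply i (hNm i).compl
  have hΓm : MeasurableSet Γ := Measure.isClosed_support.measurableSet.inter
    (MeasurableSet.univ_pi fun i => (hXo i).measurableSet)
  have hOae : ∀ᵐ x ∂π, x ∈ O := by
    refine ae_all_iff.2 fun i => ?_
    by_cases hi : i ∈ I
    · have h1 : ∀ᵐ t ∂(π.map fun x => x i), t ∉ N i := by
        rw [hπ.1.2.2 i]
        exact measure_eq_zero_iff_ae_notMem.1 (hi (hN0 i))
      filter_upwards [ae_of_ae_map (measurable_pi_apply i).aemeasurable h1] with x hx _ using hx
    · exact Filter.Eventually.of_forall fun x h => absurd h hi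
  have hXae : ∀ᵐ x ∂π, x ∈ Set.univ.pi X := hπ.1.2.1
  have hsae : ∀ᵐ x ∂π, x ∈ π.support := Measure.support_mem_ae
  refine hπ.1.isInducedByMap (hΓm.inter hOm) ?_ (fun x hx => hx.1.2) hinj
  have : ∀ᵐ x ∂π, x ∈ Γ ∩ O := by
    filter_upwards [hOae, hXae, hsae] with x h1 h2 h3 using ⟨⟨h3, h2⟩, h1⟩
  exact this
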